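/- Let $A$ be a finite alphabet, let $A^{-1}=\{a^{-1}:a\in A\}$ be a disjoint set of formal inverses, and let $\widetilde A=A\cup A^{-1}$ with the involution $a\leftrightarrow a^{-1}$. An \emph{inverse graph} $\Gamma$ over $\widetilde A$ is a directed graph (loops and multiple edges allowed) whose edges $e$ carry labels $\lambda(e)\in\widetilde A$, together with an involution $e\mapsto e^{-1}$ on its edges such that $e^{-1}\neq e$, $e^{-1}$ runs from the terminal to the initial vertex of $e$, and $\lambda(e^{-1})=\lambda(e)^{-1}$, and such that $\Gamma$ is deterministic (for every vertex $v$ and every $a\in\widetilde A$ at most one edge with label $a$ starts at $v$) and connected (any two vertices are joined by a walk). Let $d$ denote the distance on the vertex set $V(\Gamma)$, that is, $d(u,v)$ is the least length of a walk from $u$ to $v$. For a vertex $x_0$ of $\Gamma$, the rooted inverse graph $(\Gamma,x_0)$ is called \emph{context-free} if the language $L(\Gamma,x_0)\subseteq\widetilde A^{*}$ of the labels of all walks from $x_0$ to $x_0$ (the empty walk included) is a context-free language, i.e. is generated by a context-free grammar. \textbf{Proposition.} If the rooted inverse graph $(\Gamma,x_0)$ is context-free, then $\Gamma$ is quasi-isometric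 to a tree: there are a tree $T$ with graph distance $d_T$ on its vertex set $V(T)$, a map $\psi:V(\Gamma)\to V(T)$, positive constants $k,K,c,C$ and a constant $N$ such that \[ k\,d(x,y)-c\;\le\; d_T(\psi(x),\psi(y))\;\le\; K\,d(x,y)+C\qquad\text{for all }x,y\in V(\Gamma), \] and for every $z\in V(T)$ there is an $x\in V(\Gamma)$ with $d_T(\psi(x),z)\le N$. -/

import Mathlib

/-- A digraph with vertex set `V`, edge set `E` and edges labelled by letters of `L`
(loops and multiple edges are allowed). -/
structure LabeledDigraph (L V E : Type*) where
  /-- initial vertex of an edge -/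
  init : E → V
  /-- terminal vertex of an edge -/
  term : E → V
  /-- label of an edge -/
  label : E → L

namespace LabeledDigraph

variable {L V E : Type*}

/-- `G.IsWalk u p v`: the list `p` of successive edges is a walk from `u` to `v`;
the empty list is the empty walk from a vertex to itself. -/
def IsWalk (G : LabeledDigraph L V E) : V → List E → V → Prop
  | u, [], v => u = v
  | u, e :: p, v => G.init e = u ∧ G.IsWalk (G.term e) p v

/-- At each vertex there is at most one outgoing edge with a given label. -/
def Deterministic (G : LabeledDigraph L V E) : Prop :=
  ∀ e f : E, G.init e = G.init f → G.label e = G.label f → e = f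

/-- Any two vertices are connected by a walk. -/
def Connected (G : LabeledDigraph L V E) : Prop :=
  ∀ u v : V, ∃ p : List E, G.IsWalk u p v

/-- The language accepted by the rooted graph `(G, x₀)`: the labels of all circuits at `x₀`. -/
def acceptedLanguage (G : LabeledDigraph L V E) (x₀ : V) : Language L :=
  {w | ∃ p : List E, G.IsWalk x₀ p x₀ ∧ p.map G.label = w}

/-- The least length of a walk from `u` to `v` (the graph distance when `G` is connected). -/
noncomputable def dist (G : LabeledDigraph L V E) (u v : V) : ℕ :=
  sInf {n | ∃ p : List E, G.IsWalk u p v ∧ p.length = n}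

end LabeledDigraph

/-- Formal inversion on the involutive alphabet `A ∪ A⁻¹`, realised as `A × Bool`:
`(a, true)` is the letter `a` and `(a, false)` is the letter `a⁻¹`. -/
def letterInv {A : Type*} (x : A × Bool) : A × Bool := (x.1, !x.2)

/-- An involutive digraph over the involutive alphabet `A ∪ A⁻¹`. -/
structure InvolutiveGraph (A V E : Type*) extends LabeledDigraph (A × Bool) V E where
  /-- the involution on edges -/
  inv : E → E
  inv_inv : ∀ e, inv (inv e) = e
  init_inv : ∀ e, init (inv e) = term e
  term_inv : ∀ e, term (inv e) = init e
  label_inv : ∀ e, label (inv e) = letterInv (label e)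
  inv_ne : ∀ e, inv e ≠ e

/-- An inverse graph: an involutive graph that is deterministic and connected. -/
structure InverseGraph (A V E : Type*) extends InvolutiveGraph A V E where
  deterministic : toLabeledDigraph.Deterministic
  connected : toLabeledDigraph.Connected

/-- The rooted inverse graph `(Γ, x₀)` is context-free: the language of the labels of its circuits
at the root is a context-free language. -/
def InverseGraph.IsContextFree {A V E : Type*} (Γ : InverseGraph A V E) (x₀ : V) : Prop :=
  (Γ.acceptedLanguage x₀).IsContextFree

/-- `f` is a quasi-isometry from `X` with distance `d₁` to `Y` with distance `d₂`. -/
def IsQuasiIsometry {X Y : Type*} (d₁ : X → X → ℝ) (d₂ : Y → Y → ℝ) (f : X → Y) : Prop :=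
  (∃ k K c C : ℝ, 0 < k ∧ 0 < K ∧ 0 < c ∧ 0 < C ∧
    ∀ x y : X, k * d₁ x y - c ≤ d₂ (f x) (f y) ∧ d₂ (f x) (f y) ≤ K * d₁ x y + C) ∧
  ∃ N : ℝ, ∀ z : Y, ∃ x : X, d₂ (f x) z ≤ N

/-- The inverse graph `Γ`, with its graph distance on vertices, is quasi-isometric to the
vertex set of some tree with its graph distance. -/
def InverseGraph.QuasiIsometricToTree.{u, v, w} {A : Type u} {V : Type v} {E : Type w}
    (Γ : InverseGraph A V E) : Prop :=
  ∃ (T : Type v) (G : SimpleGraph T), G.IsTree ∧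
    ∃ f : V → T,
      IsQuasiIsometry (fun u v => (Γ.dist u v : ℝ)) (fun s t => (G.dist s t : ℝ)) f

/-!
The proof has a grammatical half, which shows that closed walks at the root `x₀` are thin, and a
geometric half, which turns thinness into a tree.

Let a context-free grammar generate the circuit labels at `x₀`, and read a circuit along one of its
parse trees. Replacing the subtree below a node by any other parse tree with the same root symbol
gives another circuit label. Since `Γ` is deterministic both forwards and backwards, the part of the
circuit outside the subtree is read along the same walk, so all words derived from that node run
between the same two vertices. Taking a shortest such word, the two ends of every node are
within a distance `M` that depends only on the grammar; the same holds for the blocks into which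
the children of a node are divided. Now cut a circuit into three arcs and descend to the
last node whose span contains the middle arc. Unless that arc has at most one letter, a cut between
the children of the node falls strictly inside it, so a point of the middle arc is within `M` of
a point of the first arc and of a point of the
third arc (`InverseGraph.isPinched_of_yields`).

Apply this to a geodesic from `x₀` to `x`, a walk from `x` to `y` that stays outside the open
`n`-ball, and a geodesic back from `y` to `x₀`, where `x` and `y` are at distance `n` from `x₀`.
The pinch must occur within `M` of `x` and of `y` on the geodesics, whence `d(x, y) ≤ 4 * M`
(`InverseGraph.dist_le_of_joinedOutside`). So each component of the complement of the open `n`-ball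
meets the `n`-sphere in a set of bounded diameter.

These components, over all `n`, are the vertices of a tree in which the parent of a component is the
component at radius `n - 1` containing it (`InverseGraph.isTree_componentTree`). Sending a vertex
at distance `n` to its component is surjective and does not increase distances, and as its
fibres have bounded diameter and adjacent tree vertices have adjacent points in their fibres, it
shrinks distances by at most a constant factor and an additive constant
(`InverseGraph.isQuasiIsometry_toComponent`).
-/

/-! ### Big-step derivations of context-free grammars -/

namespace ContextFreeGrammar

variable {T : Type*} {g : ContextFreeGrammar T}

/-- Big-step semantics of a context-free grammar: `g.Yields s w` means that the sentential form `s`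
derives the terminal word `w`. A proof is a parse forest whose roots are the symbols of `s`, so
induction on it is induction on parse trees. -/
inductive Yields (g : ContextFreeGrammar T) : List (Symbol T g.NT) → List T → Prop
  | nil : Yields g [] []
  | terminal (t : T) {s : List (Symbol T g.NT)} {w : List T} (h : Yields g s w) :
      Yields g (.terminal t :: s) (t :: w)
  | nonterminal {r : ContextFreeRule T g.NT} (hr : r ∈ g.rules) {s : List (Symbol T g.NT)}
      {w₁ w₂ : List T} (h₁ : Yields g r.output w₁) (h₂ : Yields g s w₂) :
      Yields g (.nonterminal r.input :: s) (w₁ ++ w₂)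

theorem Yields.of_terminals (w : List T) : g.Yields (w.map .terminal) w := by
  induction w with
  | nil => exact .nil
  | cons t w ih => exact .terminal t ih

theorem Yields.append {s₁ s₂ : List (Symbol T g.NT)} {w₁ w₂ : List T} (h₁ : g.Yields s₁ w₁)
    (h₂ : g.Yields s₂ w₂) : g.Yields (s₁ ++ s₂) (w₁ ++ w₂) := by
  induction h₁ with
  | nil => exact h₂
  | terminal t _ ih => exact .terminal t ih
  | nonterminal hr h _ _ ih => rw [List.append_assoc]; exact .nonterminal hr h ih

theorem Yields.exists_append {s₁ s₂ : List (Symbol T g.NT)} {w : List T}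
    (h : g.Yields (s₁ ++ s₂) w) :
    ∃ w₁ w₂, w = w₁ ++ w₂ ∧ g.Yields s₁ w₁ ∧ g.Yields s₂ w₂ := by
  induction s₁ generalizing w with
  | nil => exact ⟨[], w, rfl, .nil, h⟩
  | cons x s₁ ih =>
    cases h with
    | terminal t h =>
      obtain ⟨w₁, w₂, rfl, h₁, h₂⟩ := ih h
      exact ⟨t :: w₁, w₂, rfl, .terminal t h₁, h₂⟩
    | nonterminal hr h h' =>
      obtain ⟨w₁, w₂, rfl, h₁, h₂⟩ := ih h'
      exact ⟨_, w₂, (List.append_assoc _ _ _).symm, .nonterminal hr h h₁, h₂⟩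

theorem Yields.exists_rule {n : g.NT} {w : List T} (h : g.Yields [.nonterminal n] w) :
    ∃ r ∈ g.rules, r.input = n ∧ g.Yields r.output w := by
  generalize hs : [Symbol.nonterminal n] = s at h
  cases h with
  | nil => cases hs
  | terminal t h => cases hs
  | @nonterminal r hr _ w₁ w₂ h₁ h₂ =>
    obtain ⟨hn, rfl⟩ := List.cons.inj hs
    cases h₂
    exact ⟨r, hr, (Symbol.nonterminal.inj hn).symm, by rwa [List.append_nil]⟩

theorem Yields.of_rewrites {r : ContextFreeRule T g.NT} (hr : r ∈ g.rules)
    {s s' : List (Symbol T g.NT)} (h : r.Rewrites s s') {w : List T} (hw : g.Yields s' w) :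
    g.Yields s w := by
  induction h generalizing w with
  | head s =>
    obtain ⟨w₁, w₂, rfl, h₁, h₂⟩ := hw.exists_append
    exact .nonterminal hr h₁ h₂
  | cons x _ ih =>
    cases hw with
    | terminal t h => exact .terminal t (ih h)
    | nonterminal hr' h h' => exact .nonterminal hr' h (ih h')

theorem Yields.derives {s : List (Symbol T g.NT)} {w : List T} (h : g.Yields s w) :
    g.Derives s (w.map .terminal) := by
  induction h with
  | nil => rfl
  | terminal t _ ih => exact ih.append_left [.terminal t]
  | @nonterminal r hr s w₁ w₂ _ _ ih₁ ih₂ =>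
    rw [List.map_append]
    have h₀ : g.Produces (.nonterminal r.input :: s) (r.output ++ s) := ⟨r, hr, .head s⟩
    exact h₀.trans_derives ((ih₁.append_right s).trans (ih₂.append_left _))

theorem yields_iff_derives {s : List (Symbol T g.NT)} {w : List T} :
    g.Yields s w ↔ g.Derives s (w.map .terminal) := by
  refine ⟨Yields.derives, fun h ↦ ?_⟩
  induction h using Relation.ReflTransGen.head_induction_on with
  | refl => exact .of_terminals w
  | head h _ ih =>
    obtain ⟨r, hr, h⟩ := h
    exact .of_rewrites hr h ih

theorem mem_language_iff_yields {w : List T} :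
    w ∈ g.language ↔ g.Yields [.nonterminal g.initial] w := by
  rw [yields_iff_derives, mem_language_iff]

/-- `g.HasShortYield M s`: if the sentential form `s` yields any word at all, then it yields one of
length at most `M`. -/
def HasShortYield (g : ContextFreeGrammar T) (M : ℕ) (s : List (Symbol T g.NT)) : Prop :=
  ∀ w, g.Yields s w → ∃ w', g.Yields s w' ∧ w'.length ≤ M

theorem exists_forall_hasShortYield {F : Set (List (Symbol T g.NT))} (hF : F.Finite) :
    ∃ M, 1 ≤ M ∧ ∀ s ∈ F, g.HasShortYield M s := by
  have key (s : List (Symbol T g.NT)) : ∃ m, g.HasShortYield m s := by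
    by_cases h : ∃ w, g.Yields s w
    · obtain ⟨w, hw⟩ := h
      exact ⟨w.length, fun _ _ ↦ ⟨w, hw, le_rfl⟩⟩
    · exact ⟨0, fun w hw ↦ (h ⟨w, hw⟩).elim⟩
  choose m hm using key
  obtain ⟨B, hB⟩ := (hF.image m).bddAbove
  refine ⟨B + 1, Nat.le_add_left 1 B, fun s hs w hw ↦ ?_⟩
  obtain ⟨w', hw', hlen⟩ := hm s w hw
  exact ⟨w', hw', hlen.trans ((hB ⟨s, hs, rfl⟩).trans B.le_succ)⟩

/-- The bound covers exactly the sentential forms met when a parse tree is read from top to bottom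
and each right-hand side from left to right. -/
theorem exists_bound_hasShortYield (g : ContextFreeGrammar T) :
    ∃ M, 1 ≤ M ∧ ∀ r ∈ g.rules, ∀ s, s <:+ r.output → g.HasShortYield M s := by
  have hfin (r : ContextFreeRule T g.NT) : {s | s <:+ r.output}.Finite :=
    (List.finite_toSet r.output.tails).subset fun s hs ↦ (List.mem_tails s _).2 hs
  obtain ⟨M, hM, h⟩ := exists_forall_hasShortYield (g := g)
    (F := ⋃ r ∈ g.rules, {s | s <:+ r.output})
    (g.rules.finite_toSet.biUnion fun r _ ↦ hfin r)
  exact ⟨M, hM, fun r hr s hs ↦ h s (Set.mem_biUnion (Finset.mem_coe.2 hr) hs)⟩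

end ContextFreeGrammar

/-! ### Walks through their labels -/

namespace LabeledDigraph

variable {L V E : Type*} {G : LabeledDigraph L V E}

/-- `G.Reads u w v`: some walk from `u` to `v` has label `w`. -/
def Reads (G : LabeledDigraph L V E) (u : V) (w : List L) (v : V) : Prop :=
  ∃ p : List E, G.IsWalk u p v ∧ p.map G.label = w

theorem reads_nil {u v : V} : G.Reads u [] v ↔ u = v := by
  constructor
  · rintro ⟨p, hp, h⟩
    obtain rfl := List.map_eq_nil_iff.1 h
    exact hp
  · rintro rfl
    exact ⟨[], rfl, rfl⟩

theorem reads_cons {u v : V} {a : L} {w : List L} :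
    G.Reads u (a :: w) v ↔ ∃ e, G.init e = u ∧ G.label e = a ∧ G.Reads (G.term e) w v := by
  constructor
  · rintro ⟨p, hp, h⟩
    cases p with
    | nil => simp at h
    | cons e p =>
      obtain ⟨h₁, h₂⟩ := List.cons.inj h
      exact ⟨e, hp.1, h₁, p, hp.2, h₂⟩
  · rintro ⟨e, h₁, h₂, p, hp, h⟩
    exact ⟨e :: p, ⟨h₁, hp⟩, by simp [h₂, h]⟩

theorem reads_append {u v : V} {w₁ w₂ : List L} :
    G.Reads u (w₁ ++ w₂) v ↔ ∃ m, G.Reads u w₁ m ∧ G.Reads m w₂ v := by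
  induction w₁ generalizing u with
  | nil => simp [reads_nil]
  | cons a w₁ ih =>
    simp only [List.cons_append, reads_cons, ih]
    constructor
    · rintro ⟨e, h₁, h₂, m, h₃, h₄⟩
      exact ⟨m, ⟨e, h₁, h₂, h₃⟩, h₄⟩
    · rintro ⟨m, ⟨e, h₁, h₂, h₃⟩, h₄⟩
      exact ⟨e, h₁, h₂, m, h₃, h₄⟩

theorem Reads.append {u m v : V} {w₁ w₂ : List L} (h₁ : G.Reads u w₁ m) (h₂ : G.Reads m w₂ v) :
    G.Reads u (w₁ ++ w₂) v :=
  reads_append.2 ⟨m, h₁, h₂⟩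

theorem Reads.eq_of_deterministic (hG : G.Deterministic) {u v v' : V} {w : List L}
    (h : G.Reads u w v) (h' : G.Reads u w v') : v = v' := by
  induction w generalizing u with
  | nil => exact (reads_nil.1 h).symm.trans (reads_nil.1 h')
  | cons a w ih =>
    obtain ⟨e, h₁, h₂, h₃⟩ := reads_cons.1 h
    obtain ⟨e', h₁', h₂', h₃'⟩ := reads_cons.1 h'
    obtain rfl := hG e e' (h₁.trans h₁'.symm) (h₂.trans h₂'.symm)
    exact ih h₃ h₃'

theorem Reads.dist_le {u v : V} {w : List L} (h : G.Reads u w v) : G.dist u v ≤ w.length := by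
  obtain ⟨p, hp, rfl⟩ := h
  exact Nat.sInf_le ⟨p, hp, (List.length_map _).symm⟩

theorem dist_self (u : V) : G.dist u u = 0 :=
  Nat.le_zero.1 (reads_nil.2 rfl : G.Reads u [] u).dist_le

theorem Connected.exists_reads (hG : G.Connected) (u v : V) :
    ∃ w, G.Reads u w v ∧ w.length = G.dist u v := by
  obtain ⟨p, hp⟩ := hG u v
  obtain ⟨q, hq, hlen⟩ :=
    Nat.sInf_mem (s := {n | ∃ p : List E, G.IsWalk u p v ∧ p.length = n}) ⟨_, p, hp, rfl⟩
  exact ⟨q.map G.label, ⟨q, hq, rfl⟩, (List.length_map _).trans hlen⟩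

theorem Connected.dist_triangle (hG : G.Connected) (u v w : V) :
    G.dist u w ≤ G.dist u v + G.dist v w := by
  obtain ⟨p, hp, hp'⟩ := hG.exists_reads u v
  obtain ⟨q, hq, hq'⟩ := hG.exists_reads v w
  have := (hp.append hq).dist_le
  rwa [List.length_append, hp', hq'] at this

end LabeledDigraph

namespace InverseGraph

open LabeledDigraph ContextFreeGrammar

variable {A V E : Type*} {Γ : InverseGraph A V E}

/-- Walks can be reversed; the label is inverted letter by letter and read backwards. -/
theorem reads_reverse {u v : V} {w : List (A × Bool)} (h : Γ.Reads u w v) :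
    Γ.Reads v (w.reverse.map letterInv) u := by
  induction w generalizing u with
  | nil => exact reads_nil.2 (reads_nil.1 h).symm
  | cons a w ih =>
    obtain ⟨e, rfl, rfl, he⟩ := reads_cons.1 h
    rw [List.reverse_cons, List.map_append]
    refine (ih he).append (reads_cons.2 ⟨Γ.inv e, Γ.init_inv e, Γ.label_inv e, ?_⟩)
    exact reads_nil.2 (Γ.term_inv e)

/-- Inverse graphs are also deterministic backwards. -/
theorem reads_left_unique {u u' v : V} {w : List (A × Bool)} (h : Γ.Reads u w v)
    (h' : Γ.Reads u' w v) : u = u' :=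
  (reads_reverse h).eq_of_deterministic Γ.deterministic (reads_reverse h')

theorem dist_comm (u v : V) : Γ.dist u v = Γ.dist v u := by
  have key (u v : V) : Γ.dist v u ≤ Γ.dist u v := by
    obtain ⟨w, hw, hlen⟩ := Γ.connected.exists_reads u v
    simpa [hlen] using (reads_reverse hw).dist_le
  exact le_antisymm (key v u) (key u v)

/-! ### Closed walks are thin -/

/-- `Γ.IsPinched M p w q`: however the word `w`, read from `p` to `q`, is cut into three successive
arcs, there are points `e`, `f`, `h` on the first, second and third arc such that `f` is within
distance `M` of both `e` and `h`. -/
def IsPinched (Γ : InverseGraph A V E) (M : ℕ) (p : V) (w : List (A × Bool)) (q : V) : Prop :=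
  ∀ α γ β, w = α ++ (γ ++ β) → ∃ α₁ α₂ γ₁ γ₂ β₁ β₂ e f h,
    α = α₁ ++ α₂ ∧ γ = γ₁ ++ γ₂ ∧ β = β₁ ++ β₂ ∧
    Γ.Reads p α₁ e ∧ Γ.Reads e (α₂ ++ γ₁) f ∧ Γ.Reads f (γ₂ ++ β₁) h ∧ Γ.Reads h β₂ q ∧
    Γ.dist e f ≤ M ∧ Γ.dist f h ≤ M

theorem isPinched_of_length_le {M : ℕ} {p q : V} {w : List (A × Bool)} (h : Γ.Reads p w q)
    (hw : w.length ≤ M) : Γ.IsPinched M p w q := by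
  rintro α γ β rfl
  obtain ⟨e, h₁, h₂⟩ := reads_append.1 h
  obtain ⟨f, h₂, h₃⟩ := reads_append.1 h₂
  refine ⟨α, [], γ, [], [], β, e, f, f, by simp, by simp, by simp, h₁, h₂, reads_nil.2 rfl, h₃,
    ?_, ?_⟩
  · have := h₂.dist_le
    simp only [List.length_append] at hw
    omega
  · simp [dist_self]

theorem IsPinched.append {M : ℕ} {p m q : V} {w₁ w₂ : List (A × Bool)}
    (h₁ : Γ.IsPinched M p w₁ m) (h₂ : Γ.IsPinched M m w₂ q) (r₁ : Γ.Reads p w₁ m)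
    (r₂ : Γ.Reads m w₂ q) (d₁ : Γ.dist p m ≤ M) (d₂ : Γ.dist m q ≤ M) :
    Γ.IsPinched M p (w₁ ++ w₂) q := by
  intro α γ β hw
  rcases List.append_eq_append_iff.1 hw with ⟨α', rfl, rfl⟩ | ⟨δ, rfl, hδ⟩
  · -- The junction of `w₁` and `w₂` lies on the first arc.
    obtain ⟨α₁, α₂, γ₁, γ₂, β₁, β₂, e, f, h, rfl, rfl, rfl, k₁, k₂, k₃, k₄, k₅, k₆⟩ :=
      h₂ α' γ β rfl
    exact ⟨w₁ ++ α₁, α₂, γ₁, γ₂, β₁, β₂, e, f, h, by simp, rfl, rfl, r₁.append k₁, k₂, k₃, k₄,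
      k₅, k₆⟩
  rcases List.append_eq_append_iff.1 hδ with ⟨β', rfl, rfl⟩ | ⟨γ', rfl, rfl⟩
  · -- The junction lies on the third arc.
    obtain ⟨α₁, α₂, γ₁, γ₂, β₁, β₂, e, f, h, rfl, rfl, rfl, k₁, k₂, k₃, k₄, k₅, k₆⟩ :=
      h₁ α γ β' rfl
    exact ⟨α₁, α₂, γ₁, γ₂, β₁, β₂ ++ w₂, e, f, h, rfl, rfl, by simp, k₁, k₂, k₃, k₄.append r₂,
      k₅, k₆⟩
  · -- The junction lies on the middle arc, so the endpoints and the junction will do.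
    exact ⟨[], α, δ, γ', β, [], p, m, q, rfl, rfl, by simp, reads_nil.2 rfl, r₁, r₂,
      reads_nil.2 rfl, d₁, d₂⟩

/-- If a sentential form `s` has a short yield, and all its yields read from `p` to `q`, then
`p` and `q` are close. -/
theorem dist_le_of_hasShortYield {g : ContextFreeGrammar (A × Bool)} {M : ℕ}
    {s : List (Symbol (A × Bool) g.NT)} {w : List (A × Bool)} (hs : g.HasShortYield M s)
    (hw : g.Yields s w) {p q : V} (h : ∀ w', g.Yields s w' → Γ.Reads p w' q) : Γ.dist p q ≤ M := by
  obtain ⟨w', hw', hlen⟩ := hs w hw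
  exact (h w' hw').dist_le.trans hlen

/-- The grammatical heart of the argument. Determinism forwards and backwards forces all yields of
a subtree of a parse tree to share their endpoints in `Γ`, hence these endpoints are close, and
descending the parse tree to the last node spanning the middle arc produces the pinch. -/
theorem isPinched_of_yields {g : ContextFreeGrammar (A × Bool)} {M : ℕ} (hM : 1 ≤ M)
    (hg : ∀ r ∈ g.rules, ∀ s, s <:+ r.output → g.HasShortYield M s)
    {s : List (Symbol (A × Bool) g.NT)} {w : List (A × Bool)} (hw : g.Yields s w)
    (hs : ∀ s', s' <:+ s → g.HasShortYield M s') {p q : V}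
    (h : ∀ w', g.Yields s w' → Γ.Reads p w' q) : Γ.IsPinched M p w q := by
  induction hw generalizing p q with
  | nil => exact isPinched_of_length_le (h [] .nil) (Nat.zero_le M)
  | @terminal t s w hw ih =>
    obtain ⟨m, h₁, h₂⟩ := reads_append.1 (h ([t] ++ w) (.terminal t hw))
    have hm : ∀ w', g.Yields s w' → Γ.Reads m w' q := fun w' hw' ↦ by
      obtain ⟨m', k₁, k₂⟩ := reads_append.1 (h ([t] ++ w') (.terminal t hw'))
      rwa [h₁.eq_of_deterministic Γ.deterministic k₁]
    exact (isPinched_of_length_le h₁ hM).append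
      (ih (fun s' hs' ↦ hs s' (hs'.trans (List.suffix_cons _ _))) hm) h₁ h₂ (h₁.dist_le.trans hM)
      (dist_le_of_hasShortYield (hs s (List.suffix_cons _ _)) hw hm)
  | @nonterminal r hr s w₁ w₂ hw₁ hw₂ ih₁ ih₂ =>
    obtain ⟨m, h₁, h₂⟩ := reads_append.1 (h _ (.nonterminal hr hw₁ hw₂))
    have hm : ∀ w', g.Yields s w' → Γ.Reads m w' q := fun w' hw' ↦ by
      obtain ⟨m', k₁, k₂⟩ := reads_append.1 (h _ (.nonterminal hr hw₁ hw'))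
      rwa [h₁.eq_of_deterministic Γ.deterministic k₁]
    have hout : ∀ w', g.Yields r.output w' → Γ.Reads p w' m := fun w' hw' ↦ by
      obtain ⟨m', k₁, k₂⟩ := reads_append.1 (h _ (.nonterminal hr hw' hw₂))
      rwa [reads_left_unique h₂ k₂]
    exact (ih₁ (hg r hr) hout).append
      (ih₂ (fun s' hs' ↦ hs s' (hs'.trans (List.suffix_cons _ _))) hm) h₁ h₂
      (dist_le_of_hasShortYield (hg r hr _ List.suffix_rfl) hw₁ hout)
      (dist_le_of_hasShortYield (hs s (List.suffix_cons _ _)) hw₂ hm)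

theorem IsContextFree.exists_isPinched {x₀ : V} (h : Γ.IsContextFree x₀) :
    ∃ M, ∀ w, Γ.Reads x₀ w x₀ → Γ.IsPinched M x₀ w x₀ := by
  obtain ⟨g, hg⟩ := h
  obtain ⟨M, hM, hshort⟩ := g.exists_bound_hasShortYield
  have key (w) : Γ.Reads x₀ w x₀ ↔ g.Yields [.nonterminal g.initial] w := by
    rw [← mem_language_iff_yields, hg]
    rfl
  refine ⟨M, fun w hw ↦ ?_⟩
  obtain ⟨r, hr, hin, hw'⟩ := ((key w).1 hw).exists_rule
  refine isPinched_of_yields hM hshort hw' (hshort r hr) fun w' hw' ↦ (key w').2 ?_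
  simpa [hin] using Yields.nonterminal hr hw' .nil

end InverseGraph

/-! ### Graphs given by a parent function -/

namespace SimpleGraph

variable {T : Type*}

/-- The graph joining every vertex to its parent; a root is encoded as its own parent. -/
def ofParent (parent : T → T) : SimpleGraph T :=
  SimpleGraph.fromRel fun s t ↦ parent s = t

theorem ofParent_adj {parent : T → T} {s t : T} :
    (ofParent parent).Adj s t ↔ s ≠ t ∧ (parent s = t ∨ parent t = s) :=
  SimpleGraph.fromRel_adj _ _ _

/-- The edge from a vertex to its parent is a bridge: once it is removed, the descendants of the
vertex form a union of components. -/
theorem not_reachable_parent {parent : T → T} {level : T → ℕ} {root : T}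
    (hroot : parent root = root) (hlevel : ∀ s, s ≠ root → level (parent s) < level s) {s : T}
    (hs : s ≠ parent s) :
    ¬ ((ofParent parent).deleteEdges {s(s, parent s)}).Reachable s (parent s) := by
  have hs₀ : s ≠ root := by
    rintro rfl
    exact hs hroot.symm
  have hmono (t : T) : level (parent t) ≤ level t := by
    by_cases ht : t = root
    · rw [ht, hroot]
    · exact (hlevel t ht).le
  have hiter (k : ℕ) (t : T) : level (parent^[k] t) ≤ level t := by
    induction k generalizing t with
    | zero => exact le_rfl
    | succ k ih => exact (ih (parent t)).trans (hmono t)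
  have hdesc (t u : T) (p : ((ofParent parent).deleteEdges {s(s, parent s)}).Walk t u)
      (ht : ∃ k, parent^[k] t = s) : ∃ k, parent^[k] u = s := by
    induction p with
    | nil => exact ht
    | @cons t u _ hadj _ ih =>
      refine ih ?_
      obtain ⟨hadj, hne⟩ := SimpleGraph.deleteEdges_adj.1 hadj
      obtain ⟨k, hk⟩ := ht
      rcases (ofParent_adj.1 hadj).2 with rfl | rfl
      · cases k with
        | zero =>
          obtain rfl : t = s := hk
          exact (hne rfl).elim
        | succ k => exact ⟨k, hk⟩
      · exact ⟨k + 1, hk⟩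
  rintro ⟨p⟩
  obtain ⟨k, hk⟩ := hdesc _ _ p ⟨0, rfl⟩
  have h₁ := hiter k (parent s)
  rw [hk] at h₁
  exact absurd (hlevel s hs₀) (not_lt.2 h₁)

theorem isTree_ofParent {parent : T → T} {level : T → ℕ} {root : T}
    (hroot : parent root = root) (hlevel : ∀ s, s ≠ root → level (parent s) < level s) :
    (ofParent parent).IsTree := by
  have hreach (s : T) : (ofParent parent).Reachable s root := by
    induction hn : level s using Nat.strong_induction_on generalizing s with
    | _ n ih =>
      by_cases hs : s = root
      · rw [hs]
      · have hlt := hlevel s hs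
        have hne : s ≠ parent s := fun h ↦ by
          rw [← h] at hlt
          exact lt_irrefl _ hlt
        have hadj : (ofParent parent).Adj s (parent s) := ofParent_adj.2 ⟨hne, Or.inl rfl⟩
        exact hadj.reachable.trans (ih _ (hn ▸ hlt) _ rfl)
  have : Nonempty T := ⟨root⟩
  refine ⟨⟨fun s t ↦ (hreach s).trans (hreach t).symm⟩, ?_⟩
  rw [isAcyclic_iff_forall_adj_isBridge]
  intro s t hadj
  rw [isBridge_iff]
  obtain ⟨hne, rfl | rfl⟩ := ofParent_adj.1 hadj
  · exact not_reachable_parent hroot hlevel hne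
  · rw [Sym2.eq_swap]
    exact fun h ↦ not_reachable_parent hroot hlevel hne.symm h.symm

end SimpleGraph

/-! ### The tree of components outside balls -/

namespace InverseGraph

open LabeledDigraph

variable {A V E : Type*} {Γ : InverseGraph A V E} {x₀ : V}

theorem dist_le_of_edge (x : V) (e : E) : Γ.dist x (Γ.term e) ≤ Γ.dist x (Γ.init e) + 1 := by
  have h : Γ.Reads (Γ.init e) [Γ.label e] (Γ.term e) :=
    reads_cons.2 ⟨e, rfl, rfl, reads_nil.2 rfl⟩
  exact (Γ.connected.dist_triangle x _ _).trans (Nat.add_le_add_left h.dist_le _)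

theorem dist_term_init_le (e : E) : Γ.dist (Γ.term e) (Γ.init e) ≤ 1 := by
  simpa [Γ.init_inv, Γ.term_inv, dist_self] using dist_le_of_edge (Γ := Γ) (Γ.term e) (Γ.inv e)

/-- Every vertex other than the root is the end of an edge that starts one step closer to it. -/
theorem exists_edge_from_closer {x : V} (h : x ≠ x₀) :
    ∃ e, Γ.term e = x ∧ Γ.dist x₀ (Γ.init e) + 1 = Γ.dist x₀ x := by
  obtain ⟨w, hw, hlen⟩ := Γ.connected.exists_reads x₀ x
  rcases List.eq_nil_or_concat' w with rfl | ⟨w, a, rfl⟩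
  · exact (h (reads_nil.1 hw).symm).elim
  · obtain ⟨m, h₁, h₂⟩ := reads_append.1 hw
    obtain ⟨e, rfl, rfl, h₃⟩ := reads_cons.1 h₂
    obtain rfl := reads_nil.1 h₃
    refine ⟨e, rfl, le_antisymm ?_ (dist_le_of_edge x₀ e)⟩
    have := h₁.dist_le
    rw [List.length_append, List.length_singleton] at hlen
    omega

/-- `Γ.JoinedOutside x₀ n x y`: some walk from `x` to `y` has all its vertices at distance at least
`n` from `x₀`. -/
def JoinedOutside (Γ : InverseGraph A V E) (x₀ : V) (n : ℕ) (x y : V) : Prop :=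
  n ≤ Γ.dist x₀ x ∧ Relation.ReflTransGen
    (fun u v ↦ n ≤ Γ.dist x₀ v ∧ ∃ e, Γ.init e = u ∧ Γ.term e = v) x y

theorem JoinedOutside.le_right {n : ℕ} {x y : V} (h : Γ.JoinedOutside x₀ n x y) :
    n ≤ Γ.dist x₀ y := by
  obtain ⟨h₀, h⟩ := h
  cases h with
  | refl => exact h₀
  | tail _ h => exact h.1

theorem joinedOutside_refl {n : ℕ} {x : V} (h : n ≤ Γ.dist x₀ x) : Γ.JoinedOutside x₀ n x x :=
  ⟨h, .refl⟩

theorem JoinedOutside.trans {n : ℕ} {x y z : V} (h : Γ.JoinedOutside x₀ n x y)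
    (h' : Γ.JoinedOutside x₀ n y z) : Γ.JoinedOutside x₀ n x z :=
  ⟨h.1, h.2.trans h'.2⟩

theorem joinedOutside_edge {n : ℕ} (e : E) (h : n ≤ Γ.dist x₀ (Γ.init e))
    (h' : n ≤ Γ.dist x₀ (Γ.term e)) : Γ.JoinedOutside x₀ n (Γ.init e) (Γ.term e) :=
  ⟨h, .single ⟨h', e, rfl, rfl⟩⟩

theorem JoinedOutside.symm {n : ℕ} {x y : V} (h : Γ.JoinedOutside x₀ n x y) :
    Γ.JoinedOutside x₀ n y x := by
  obtain ⟨h₀, h⟩ := h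
  induction h with
  | refl => exact joinedOutside_refl h₀
  | tail h hstep ih =>
    obtain ⟨h₁, e, rfl, rfl⟩ := hstep
    have := joinedOutside_edge (Γ := Γ) (x₀ := x₀) (n := n) (Γ.inv e)
      (by rwa [Γ.init_inv]) (by rw [Γ.term_inv]; exact JoinedOutside.le_right ⟨h₀, h⟩)
    rw [Γ.init_inv, Γ.term_inv] at this
    exact this.trans ih

theorem JoinedOutside.mono {m n : ℕ} (hmn : m ≤ n) {x y : V} (h : Γ.JoinedOutside x₀ n x y) :
    Γ.JoinedOutside x₀ m x y :=
  ⟨hmn.trans h.1, Relation.ReflTransGen.mono (fun _ _ k ↦ ⟨hmn.trans k.1, k.2⟩) _ _ h.2⟩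

theorem JoinedOutside.exists_reads {n : ℕ} {x y : V} (h : Γ.JoinedOutside x₀ n x y) :
    ∃ γ, Γ.Reads x γ y ∧ ∀ γ₁ γ₂ m, γ = γ₁ ++ γ₂ → Γ.Reads x γ₁ m → n ≤ Γ.dist x₀ m := by
  obtain ⟨h₀, h⟩ := h
  induction h with
  | refl =>
    refine ⟨[], reads_nil.2 rfl, fun γ₁ γ₂ m h hm ↦ ?_⟩
    obtain ⟨rfl, rfl⟩ := List.append_eq_nil_iff.1 h.symm
    rwa [← reads_nil.1 hm]
  | tail _ hstep ih =>
    obtain ⟨h₁, e, rfl, rfl⟩ := hstep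
    obtain ⟨γ, hγ, hout⟩ := ih
    have hfull : Γ.Reads x (γ ++ [Γ.label e]) (Γ.term e) :=
      hγ.append (reads_cons.2 ⟨e, rfl, rfl, reads_nil.2 rfl⟩)
    refine ⟨_, hfull, fun γ₁ γ₂ m h hm ↦ ?_⟩
    rcases List.eq_nil_or_concat' γ₂ with rfl | ⟨γ₂, a, rfl⟩
    · rw [List.append_nil] at h
      subst h
      rwa [← hfull.eq_of_deterministic Γ.deterministic hm]
    · rw [← List.append_assoc] at h
      exact hout γ₁ γ₂ m (List.append_inj' h rfl).1 hm

/-- Two vertices of the same sphere around `x₀` that are joined outside the open ball are close.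
The closed walk in question runs along a geodesic to `x`, then outside the ball to `y`, and back
along a geodesic. A point of either geodesic that is within `M` of a point outside the ball
is within `M` of the end of the geodesic on the sphere. -/
theorem dist_le_of_joinedOutside {M : ℕ} (hM : ∀ w, Γ.Reads x₀ w x₀ → Γ.IsPinched M x₀ w x₀)
    {n : ℕ} {x y : V} (hx : Γ.dist x₀ x = n) (hy : Γ.dist x₀ y = n)
    (h : Γ.JoinedOutside x₀ n x y) : Γ.dist x y ≤ 4 * M := by
  obtain ⟨α, hα, hαlen⟩ := Γ.connected.exists_reads x₀ x
  obtain ⟨β, hβ, hβlen⟩ := Γ.connected.exists_reads y x₀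
  obtain ⟨γ, hγ, hout⟩ := h.exists_reads
  obtain ⟨α₁, α₂, γ₁, γ₂, β₁, β₂, e, f, k, rfl, rfl, rfl, h₁, h₂, h₃, h₄, hef, hfk⟩ :=
    hM _ (hα.append (hγ.append hβ)) α γ β rfl
  obtain ⟨x', h₂, hxf⟩ := reads_append.1 h₂
  obtain rfl := hα.eq_of_deterministic Γ.deterministic (h₁.append h₂)
  obtain ⟨y', hfy, h₃⟩ := reads_append.1 h₃
  obtain rfl := hγ.eq_of_deterministic Γ.deterministic (hxf.append hfy)
  have hf := hout γ₁ γ₂ f rfl hxf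
  rw [List.length_append] at hαlen hβlen
  have d₁ := h₁.dist_le
  have d₂ := h₂.dist_le
  have d₃ := h₃.dist_le
  have d₄ := h₄.dist_le
  have t₁ := Γ.connected.dist_triangle x₀ e f
  have t₂ := Γ.connected.dist_triangle x₀ k f
  have t₃ := Γ.connected.dist_triangle x e y
  have t₄ := Γ.connected.dist_triangle e f y
  have t₅ := Γ.connected.dist_triangle f k y
  have c₁ := dist_comm (Γ := Γ) k f
  have c₂ := dist_comm (Γ := Γ) x₀ k
  have c₃ := dist_comm (Γ := Γ) x₀ y
  have c₄ := dist_comm (Γ := Γ) e x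
  have c₅ := dist_comm (Γ := Γ) y k
  omega

/-- Two vertices are identified when they are at the same distance `n` from `x₀` and lie in the same
component of the complement of the open `n`-ball. Each such component meets the `n`-sphere, so
the classes are in bijection with the pairs of a radius and a component. -/
noncomputable def sphereComponentSetoid (Γ : InverseGraph A V E) (x₀ : V) : Setoid V where
  r x y := Γ.dist x₀ x = Γ.dist x₀ y ∧ Γ.JoinedOutside x₀ (Γ.dist x₀ x) x y
  iseqv :=
    { refl := fun _ ↦ ⟨rfl, joinedOutside_refl le_rfl⟩
      symm := fun {_ _} h ↦ ⟨h.1.symm, h.2.symm.mono h.1.ge⟩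
      trans := fun {_ _ _} h h' ↦ ⟨h.1.trans h'.1, h.2.trans (h'.2.mono h.1.le)⟩ }

/-- The vertices of the tree of components outside balls. -/
noncomputable abbrev SphereComponent (Γ : InverseGraph A V E) (x₀ : V) :=
  Quotient (Γ.sphereComponentSetoid x₀)

/-- The class of a vertex of `Γ` in the tree. -/
noncomputable abbrev toComponent (Γ : InverseGraph A V E) (x₀ x : V) : Γ.SphereComponent x₀ :=
  Quotient.mk (Γ.sphereComponentSetoid x₀) x

theorem toComponent_eq {x y : V} : Γ.toComponent x₀ x = Γ.toComponent x₀ y ↔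
    Γ.dist x₀ x = Γ.dist x₀ y ∧ Γ.JoinedOutside x₀ (Γ.dist x₀ x) x y :=
  Quotient.eq

/-- The radius of the sphere that a component belongs to. -/
noncomputable def SphereComponent.level (t : Γ.SphereComponent x₀) : ℕ :=
  Quotient.lift (s := Γ.sphereComponentSetoid x₀) (Γ.dist x₀) (fun _ _ h ↦ h.1) t

theorem toComponent_eq_of_edge {e e' : E}
    (he : Γ.dist x₀ (Γ.init e) + 1 = Γ.dist x₀ (Γ.term e))
    (he' : Γ.dist x₀ (Γ.init e') + 1 = Γ.dist x₀ (Γ.term e'))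
    (h : Γ.toComponent x₀ (Γ.term e) = Γ.toComponent x₀ (Γ.term e')) :
    Γ.toComponent x₀ (Γ.init e) = Γ.toComponent x₀ (Γ.init e') := by
  obtain ⟨h₁, h₂⟩ := toComponent_eq.1 h
  refine toComponent_eq.2 ⟨by omega, ?_⟩
  have k₁ := joinedOutside_edge (Γ := Γ) (x₀ := x₀) e le_rfl (by omega)
  have k₂ := joinedOutside_edge (Γ := Γ) (x₀ := x₀) (n := Γ.dist x₀ (Γ.init e)) e' (by omega)
    (by omega)
  exact (k₁.trans (h₂.mono (by omega))).trans k₂.symm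

theorem exists_parent (t : Γ.SphereComponent x₀) : ∃ s : Γ.SphereComponent x₀,
    (t = Γ.toComponent x₀ x₀ → s = t) ∧
    ∀ e, Γ.toComponent x₀ (Γ.term e) = t → Γ.dist x₀ (Γ.init e) + 1 = Γ.dist x₀ (Γ.term e) →
      Γ.toComponent x₀ (Γ.init e) = s := by
  by_cases h : ∃ e, Γ.toComponent x₀ (Γ.term e) = t ∧
      Γ.dist x₀ (Γ.init e) + 1 = Γ.dist x₀ (Γ.term e)
  · obtain ⟨e, rfl, he⟩ := h
    refine ⟨Γ.toComponent x₀ (Γ.init e), fun h ↦ ?_, fun e' h' he' ↦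
      toComponent_eq_of_edge he' he h'⟩
    have := (toComponent_eq.1 h).1
    rw [dist_self] at this
    omega
  · exact ⟨t, fun _ ↦ rfl, fun e h₁ h₂ ↦ (h ⟨e, h₁, h₂⟩).elim⟩

/-- The component at radius `n` that contains a given component at radius `n + 1`. The component at
radius `0` is its own parent. -/
noncomputable def SphereComponent.parent (t : Γ.SphereComponent x₀) : Γ.SphereComponent x₀ :=
  (exists_parent t).choose

theorem SphereComponent.parent_root :
    (Γ.toComponent x₀ x₀).parent = Γ.toComponent x₀ x₀ :=
  (exists_parent (Γ.toComponent x₀ x₀)).choose_spec.1 rfl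

theorem SphereComponent.parent_term {e : E}
    (he : Γ.dist x₀ (Γ.init e) + 1 = Γ.dist x₀ (Γ.term e)) :
    (Γ.toComponent x₀ (Γ.term e)).parent = Γ.toComponent x₀ (Γ.init e) :=
  ((exists_parent (Γ.toComponent x₀ (Γ.term e))).choose_spec.2 e rfl he).symm

/-- The tree of components outside balls around `x₀`. -/
noncomputable def componentTree (Γ : InverseGraph A V E) (x₀ : V) :
    SimpleGraph (Γ.SphereComponent x₀) :=
  SimpleGraph.ofParent SphereComponent.parent

theorem isTree_componentTree : (Γ.componentTree x₀).IsTree := by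
  refine SimpleGraph.isTree_ofParent (level := SphereComponent.level)
    SphereComponent.parent_root fun s hs ↦ ?_
  induction s using Quotient.inductionOn with
  | h x =>
    obtain ⟨e, rfl, he⟩ := exists_edge_from_closer (Γ := Γ) (x₀ := x₀) (x := x) (by
      rintro rfl
      exact hs rfl)
    have := SphereComponent.parent_term he
    exact this ▸ Nat.lt_of_succ_le he.le

/-! ### The projection to the tree is a quasi-isometry -/

theorem dist_toComponent_edge_le (e : E) : (Γ.componentTree x₀).dist
    (Γ.toComponent x₀ (Γ.init e)) (Γ.toComponent x₀ (Γ.term e)) ≤ 1 := by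
  have key (e : E) (he : Γ.dist x₀ (Γ.init e) + 1 = Γ.dist x₀ (Γ.term e)) :
      (Γ.componentTree x₀).Adj (Γ.toComponent x₀ (Γ.term e)) (Γ.toComponent x₀ (Γ.init e)) := by
    refine SimpleGraph.ofParent_adj.2 ⟨fun h ↦ ?_, Or.inl (SphereComponent.parent_term he)⟩
    have := (toComponent_eq.1 h).1
    omega
  have h₁ := dist_le_of_edge (Γ := Γ) x₀ e
  have h₂ := dist_le_of_edge (Γ := Γ) x₀ (Γ.inv e)
  rw [Γ.init_inv, Γ.term_inv] at h₂
  rcases lt_trichotomy (Γ.dist x₀ (Γ.init e)) (Γ.dist x₀ (Γ.term e)) with h | h | h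
  · exact (SimpleGraph.dist_eq_one_iff_adj.2 (key e (by omega)).symm).le
  · rw [toComponent_eq.2 ⟨h, joinedOutside_edge e le_rfl h.le⟩, SimpleGraph.dist_self]
    exact Nat.zero_le 1
  · have := key (Γ.inv e) (by rw [Γ.init_inv, Γ.term_inv]; omega)
    rw [Γ.init_inv, Γ.term_inv] at this
    exact (SimpleGraph.dist_eq_one_iff_adj.2 this).le

theorem dist_toComponent_le (x y : V) :
    (Γ.componentTree x₀).dist (Γ.toComponent x₀ x) (Γ.toComponent x₀ y) ≤ Γ.dist x y := by
  obtain ⟨w, hw, hlen⟩ := Γ.connected.exists_reads x y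
  rw [← hlen]
  clear hlen
  induction w generalizing x with
  | nil => simp [reads_nil.1 hw]
  | cons a w ih =>
    obtain ⟨e, rfl, -, hw⟩ := reads_cons.1 hw
    have h := (isTree_componentTree (Γ := Γ) (x₀ := x₀)).connected.dist_triangle
      (u := Γ.toComponent x₀ (Γ.init e)) (v := Γ.toComponent x₀ (Γ.term e))
      (w := Γ.toComponent x₀ y)
    have h₁ := dist_toComponent_edge_le (Γ := Γ) (x₀ := x₀) e
    have h₂ := ih _ hw
    rw [List.length_cons]
    omega

/-- A component distinct from its parent contains a vertex with a neighbour in the parent. -/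
theorem exists_edge_of_parent_ne {t : Γ.SphereComponent x₀} (h : t ≠ t.parent) :
    ∃ e, Γ.toComponent x₀ (Γ.term e) = t ∧ Γ.toComponent x₀ (Γ.init e) = t.parent := by
  induction t using Quotient.inductionOn with
  | h x =>
    obtain ⟨e, rfl, he⟩ := exists_edge_from_closer (Γ := Γ) (x₀ := x₀) (x := x) (by
      rintro rfl
      exact h SphereComponent.parent_root.symm)
    exact ⟨e, rfl, (SphereComponent.parent_term he).symm⟩

theorem dist_le_of_componentTree_walk {D : ℕ}
    (hD : ∀ x y, Γ.toComponent x₀ x = Γ.toComponent x₀ y → Γ.dist x y ≤ D)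
    {s t : Γ.SphereComponent x₀} (p : (Γ.componentTree x₀).Walk s t) {x y : V}
    (hx : Γ.toComponent x₀ x = s) (hy : Γ.toComponent x₀ y = t) :
    Γ.dist x y ≤ (D + 1) * p.length + D := by
  induction p generalizing x with
  | nil => simpa using hD x y (hx.trans hy.symm)
  | @cons s u t hadj p ih =>
    -- Cross from the class `s` to the class `u` along an edge of `Γ`.
    have hcross : ∃ x₁ x₂, Γ.toComponent x₀ x₁ = s ∧ Γ.toComponent x₀ x₂ = u ∧
        Γ.dist x₁ x₂ ≤ 1 := by
      obtain ⟨hne, rfl | rfl⟩ := SimpleGraph.ofParent_adj.1 hadj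
      · obtain ⟨e, h₁, h₂⟩ := exists_edge_of_parent_ne hne
        exact ⟨_, _, h₁, h₂, dist_term_init_le e⟩
      · obtain ⟨e, h₁, h₂⟩ := exists_edge_of_parent_ne hne.symm
        exact ⟨_, _, h₂, h₁, (dist_comm _ _).trans_le (dist_term_init_le e)⟩
    obtain ⟨x₁, x₂, h₁, h₂, h₁₂⟩ := hcross
    have k₁ := hD x x₁ (hx.trans h₁.symm)
    have k₂ := ih h₂ hy
    have t₁ := Γ.connected.dist_triangle x x₁ y
    have t₂ := Γ.connected.dist_triangle x₁ x₂ y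
    rw [SimpleGraph.Walk.length_cons, Nat.mul_succ]
    omega

theorem isQuasiIsometry_toComponent {D : ℕ}
    (hD : ∀ x y, Γ.toComponent x₀ x = Γ.toComponent x₀ y → Γ.dist x y ≤ D) :
    IsQuasiIsometry (fun u v ↦ (Γ.dist u v : ℝ))
      (fun s t ↦ ((Γ.componentTree x₀).dist s t : ℝ)) (Γ.toComponent x₀) := by
  have hpos : (0 : ℝ) < D + 1 := by positivity
  refine ⟨⟨1 / (D + 1), 1, 1, 1, by positivity, one_pos, one_pos, one_pos, fun x y ↦ ⟨?_, ?_⟩⟩,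
    0, fun z ↦ ?_⟩
  · have hconn := (isTree_componentTree (Γ := Γ) (x₀ := x₀)).connected
    obtain ⟨p, hp⟩ :=
      hconn.exists_walk_length_eq_dist (Γ.toComponent x₀ x) (Γ.toComponent x₀ y)
    have h := dist_le_of_componentTree_walk hD p rfl rfl
    rw [hp] at h
    have h' : (Γ.dist x y : ℝ) ≤
        (D + 1) * (Γ.componentTree x₀).dist (Γ.toComponent x₀ x) (Γ.toComponent x₀ y) + D := by
      exact_mod_cast h
    rw [sub_le_iff_le_add, one_div_mul_eq_div, div_le_iff₀ hpos]
    linarith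
  · have h : ((Γ.componentTree x₀).dist (Γ.toComponent x₀ x) (Γ.toComponent x₀ y) : ℝ) ≤
        Γ.dist x y := by
      exact_mod_cast dist_toComponent_le x y
    linarith
  · obtain ⟨x, rfl⟩ := Quotient.exists_rep z
    exact ⟨x, by simp⟩

end InverseGraph

theorem mainTheorem4 {A V E : Type*} [Finite A] (Γ : InverseGraph A V E) (x₀ : V)
    (h : Γ.IsContextFree x₀) : Γ.QuasiIsometricToTree := by
  obtain ⟨M, hM⟩ := h.exists_isPinched
  refine ⟨Γ.SphereComponent x₀, Γ.componentTree x₀, InverseGraph.isTree_componentTree,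
    Γ.toComponent x₀, InverseGraph.isQuasiIsometry_toComponent (D := 4 * M) fun x y hxy ↦ ?_⟩
  obtain ⟨h₁, h₂⟩ := InverseGraph.toComponent_eq.1 hxy
  exact InverseGraph.dist_le_of_joinedOutside hM rfl h₁.symm h₂
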